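/- Let $N\ge 2$ and equip $\mathbb{R}^N$ with its Euclidean norm $\|\cdot\|$. For a locally Lipschitz function $f:\mathbb{R}^N\to\mathbb{R}$ and $x\in\mathbb{R}^N$, let $$\partial f(x)=\mathrm{conv}\Big\{\lim_{n\to\infty}\nabla f(x_n)\;:\; x_n\to x,\ f \text{ differentiable at each } x_n,\ \big(\nabla f(x_n)\big)_n \text{ convergent}\Big\}$$ denote the Clarke subdifferential of $f$ at $x$, where $\mathrm{conv}$ is the convex hull. A function $f$ is called $L$-Lipschitz if $|f(x)-f(y)|\le L\|x-y\|$ for all $x,y$. Let $C\subset\mathbb{R}^N$ be a compact convex set with $0\in C$, and let $L:=\max_{x\in C}\|x\|$. Then: (i) There is an everywhere differentiable, $L$-Lipschitz, compactly supported function $f:\mathbb{R}^N\to\mathbb{R}$ such that for every compact convex set $K\subset C$ with $0\in K$ there exists $x\in\mathbb{R}^N$ with $\partial f(x)=K$. (ii) If moreover $0\in\mathrm{int}(C)$, then there is a function $f$ as in (i) which in addition satisfies $\partial f(x)\subset C$ for all $x\in\mathbb{R}^N$. -/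

import Mathlib

open Set Filter Topology
open scoped NNReal

/-- The set of all limits of gradients `lim ∇f(xₙ)` along sequences `xₙ → x` of points at which
`f` is differentiable. -/
def limitingGradients {N : ℕ} (f : EuclideanSpace ℝ (Fin N) → ℝ)
    (x : EuclideanSpace ℝ (Fin N)) : Set (EuclideanSpace ℝ (Fin N)) :=
  {p | ∃ u : ℕ → EuclideanSpace ℝ (Fin N),
    (∀ n, DifferentiableAt ℝ f (u n)) ∧
    Tendsto u atTop (𝓝 x) ∧
    Tendsto (fun n => gradient f (u n)) atTop (𝓝 p)}

/-- The Clarke subdifferential `∂f(x)` of a (locally Lipschitz) function on `ℝᴺ`: the convex hull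
of the set of limits of gradients of `f` at points of differentiability converging to `x`. -/
def clarkeSubdifferential {N : ℕ} (f : EuclideanSpace ℝ (Fin N) → ℝ)
    (x : EuclideanSpace ℝ (Fin N)) : Set (EuclideanSpace ℝ (Fin N)) :=
  convexHull ℝ (limitingGradients f x)

/-- The family `𝒦_C` of nonempty compact convex subsets of `C`. -/
def compactConvexSubsets {N : ℕ} (C : Set (EuclideanSpace ℝ (Fin N))) :
    Set (Set (EuclideanSpace ℝ (Fin N))) :=
  {K | K ⊆ C ∧ K.Nonempty ∧ IsCompact K ∧ Convex ℝ K}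

/-- The family `𝒦⁰_C` of compact convex subsets of `C` that contain `0`. -/
def compactConvexSubsetsZero {N : ℕ} (C : Set (EuclideanSpace ℝ (Fin N))) :
    Set (Set (EuclideanSpace ℝ (Fin N))) :=
  {K | K ∈ compactConvexSubsets C ∧ 0 ∈ K}

/-! The nonempty compact subsets of `C` form a compact metric space, hence a continuous image of the
Cantor set: a real number codes a set. This gives reals `t k` and finite sets `F k` such that each
admissible `K` has a code `x` at which the `t k` accumulate, and `F k` is Hausdorff-close to `K`
once `t k` is near `x` and `k` is large (`exists_seq_finset_approximating`).

At height `2⁻ᵏ` above the point `t k` of a coordinate axis sits a tiny bump whose gradients lie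
almost in `conv (F k)` and almost reach every point of `F k` (`exists_bump_gradient_near`). The sum
`f` of the bumps is `O(height²)`, so it has zero gradient on the limiting hyperplane. Near the axis
point coded by `x`, the gradients are zero or come from late bumps with `t k` near `x`; as `0 ∈ K`,
their limits fill exactly `K`. If `0 ∈ int C`, the errors can be absorbed in `C`, which gives (ii);
(i) is (ii) for the ball of radius `L`. -/

/-! ### Coding compact sets by reals. -/

/-- A continuous surjection from the Cantor set onto the hyperspace of a compact set, discretized:
a sequence of reals carrying finite sets that accumulates, at suitable reals, on every compact
subset of `C` containing the origin. -/
lemma exists_seq_finset_approximating {E : Type*} [NormedAddCommGroup E] {C : Set E}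
    (hC : IsCompact C) (h0 : (0 : E) ∈ C) :
    ∃ (t : ℕ → ℝ) (F : ℕ → Finset E), (∀ k, t k ∈ Icc (0 : ℝ) 1) ∧
      (∀ k, (0 : E) ∈ F k ∧ (F k : Set E) ⊆ C) ∧
      ∀ K ⊆ C, IsCompact K → (0 : E) ∈ K → ∃ x : ℝ,
        (∀ ε > 0, ∀ n, ∃ k ≥ n, |t k - x| < ε) ∧
        ∀ ε > 0, ∃ δ > 0, ∃ n, ∀ k ≥ n, |t k - x| < δ →
          (F k : Set E) ⊆ Metric.thickening ε K ∧ K ⊆ Metric.thickening ε (F k : Set E) := by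
  classical
  have : CompactSpace C := isCompact_iff_compactSpace.mp hC
  have : Nonempty C := ⟨⟨0, h0⟩⟩
  obtain ⟨φ, hφc, hφs⟩ :=
    exists_nat_bool_continuous_surjective_of_compact (TopologicalSpace.NonemptyCompacts C)
  let ψ : cantorSet → TopologicalSpace.NonemptyCompacts C := φ ∘ cantorSetHomeomorphNatToBool
  have hψc : Continuous ψ := hφc.comp cantorSetHomeomorphNatToBool.continuous
  have hψs : Function.Surjective ψ := hφs.comp cantorSetHomeomorphNatToBool.surjective
  have : Nonempty cantorSet := ⟨⟨0, zero_mem_cantorSet⟩⟩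
  let d : ℕ → cantorSet := TopologicalSpace.denseSeq cantorSet
  have hd : DenseRange d := TopologicalSpace.denseRange_denseSeq _
  -- Unpairing repeats every term of the dense sequence infinitely often, so arbitrarily late terms
  -- come close to any code.
  let s : ℕ → cantorSet := fun k => d k.unpair.1
  let A : ℕ → Set E := fun k => Subtype.val '' (ψ (s k) : Set C)
  have hA : ∀ k, IsCompact (A k) := fun k => (ψ (s k)).isCompact.image continuous_subtype_val
  have hAC : ∀ k, A k ⊆ C := by
    rintro k _ ⟨y, -, rfl⟩
    exact y.2
  have hnet : ∀ k, ∃ G : Finset E, (G : Set E) ⊆ A k ∧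
      A k ⊆ Metric.thickening (1 / ((k : ℝ) + 1)) (G : Set E) := by
    intro k
    obtain ⟨T, hT, hTf, hc⟩ := (hA k).finite_cover_balls (e := 1 / ((k : ℝ) + 1)) (by positivity)
    refine ⟨hTf.toFinset, by simpa using hT, fun y hy => ?_⟩
    obtain ⟨z, hz, hyz⟩ := mem_iUnion₂.mp (hc hy)
    exact Metric.mem_thickening_iff.mpr ⟨z, by simpa using hz, hyz⟩
  choose G hGA hGt using hnet
  -- The coded set need not contain `0`. Inserting `0` does no harm near the codes that matter,
  -- since `0 ∈ K`.
  refine ⟨fun k => (s k : ℝ), fun k => insert 0 (G k),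
    fun k => cantorSet_subset_unitInterval (s k).2, fun k => ⟨by simp, ?_⟩, ?_⟩
  · rw [Finset.coe_insert]
    exact insert_subset h0 ((hGA k).trans (hAC k))
  intro K hKC hK hK0
  have hK' : IsCompact (Subtype.val ⁻¹' K : Set C) :=
    Topology.IsInducing.subtypeVal.isCompact_preimage_iff (by simpa using hKC) |>.mpr hK
  obtain ⟨x, hx⟩ := hψs ⟨⟨Subtype.val ⁻¹' K, hK'⟩, ⟨⟨0, h0⟩, hK0⟩⟩
  refine ⟨x, fun ε hε n => ?_, fun ε hε => ?_⟩
  · obtain ⟨m, hm⟩ := Metric.denseRange_iff.mp hd x ε hε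
    refine ⟨Nat.pair m n, Nat.right_le_pair m n, ?_⟩
    simpa [s, Nat.unpair_pair, ← Real.dist_eq, dist_comm, Subtype.dist_eq] using hm
  · obtain ⟨δ, hδ, hcont⟩ := Metric.continuous_iff.mp hψc x (ε / 2) (by positivity)
    obtain ⟨n, hn⟩ := exists_nat_one_div_lt (half_pos hε)
    refine ⟨δ, hδ, n, fun k hk hkx => ?_⟩
    have hH : Metric.hausdorffDist (ψ (s k) : Set C) (ψ x : Set C) < ε / 2 := by
      rw [← Metric.NonemptyCompacts.dist_eq]
      exact hcont _ (by rwa [Subtype.dist_eq, Real.dist_eq])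
    have hfin : Metric.hausdorffEDist (ψ (s k) : Set C) (ψ x : Set C) ≠ ⊤ :=
      Metric.hausdorffEDist_ne_top_of_nonempty_of_bounded (ψ (s k)).nonempty (ψ x).nonempty
        (ψ (s k)).isCompact.isBounded (ψ x).isCompact.isBounded
    have hxK : (ψ x : Set C) = Subtype.val ⁻¹' K := by rw [hx]; rfl
    constructor
    · intro y hy
      rw [Finset.coe_insert] at hy
      rcases hy with rfl | hy
      · exact Metric.self_subset_thickening hε K hK0
      obtain ⟨y', hy', rfl⟩ := hGA k hy
      obtain ⟨z, hz, hyz⟩ := Metric.exists_dist_lt_of_hausdorffDist_lt hy' hH hfin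
      rw [hxK] at hz
      exact Metric.mem_thickening_iff.mpr ⟨z, hz, by rw [← Subtype.dist_eq]; linarith⟩
    · intro y hy
      have hy' : (⟨y, hKC hy⟩ : C) ∈ (ψ x : Set C) := by rw [hxK]; exact hy
      obtain ⟨z, hz, hyz⟩ := Metric.exists_dist_lt_of_hausdorffDist_lt' hy' hH hfin
      obtain ⟨w, hw, hzw⟩ := Metric.mem_thickening_iff.mp (hGt k ⟨z, hz, rfl⟩)
      refine Metric.mem_thickening_iff.mpr ⟨w, by simp [Finset.mem_coe.mp hw], ?_⟩
      have h1 : (1 : ℝ) / (k + 1) ≤ 1 / (n + 1) := by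
        have : (n : ℝ) ≤ k := by exact_mod_cast hk
        gcongr
      have h2 : dist (z : E) y < ε / 2 := by simpa [Subtype.dist_eq] using hyz
      have := dist_triangle_left y w (z : E)
      linarith

/-! ### Bumps with prescribed gradients. -/

/-- The positive part of the identity, smoothed at the origin to class `C¹`. -/
lemma exists_smoothed_posPart {ε : ℝ} (hε : 0 < ε) :
    ∃ Θ Θ' : ℝ → ℝ, (∀ u, HasDerivAt Θ (Θ' u) u) ∧ (∀ u, 0 ≤ Θ' u ∧ Θ' u ≤ 1) ∧
      (∀ u ≤ 0, Θ u = 0 ∧ Θ' u = 0) ∧ (∀ u, 0 ≤ u → u - ε ≤ Θ u ∧ 0 ≤ Θ u ∧ Θ u ≤ u) := by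
  -- For `u > 0`, `u² / (u + ε) = u - ε + ε² / (u + ε)`.
  refine ⟨fun u => if u ≤ 0 then 0 else u ^ 2 / (u + ε),
    fun u => if u ≤ 0 then 0 else 1 - ε ^ 2 / (u + ε) ^ 2, ?_, ?_, ?_, ?_⟩
  · intro u
    rcases lt_trichotomy u 0 with hu | rfl | hu
    · simp only [hu.le, if_true]
      refine (hasDerivAt_const u (0 : ℝ)).congr_of_eventuallyEq ?_
      filter_upwards [Iio_mem_nhds hu] with v hv
      simp [le_of_lt (mem_Iio.mp hv)]
    · simp only [le_refl, if_true]
      rw [hasDerivAt_iff_isLittleO]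
      simp only [le_refl, if_true, sub_zero, smul_zero]
      refine Asymptotics.IsBigO.trans_isLittleO (g := fun v : ℝ => v ^ 2) ?_ ?_
      · refine Asymptotics.IsBigO.of_bound (1 / ε) (Eventually.of_forall fun v => ?_)
        split_ifs with hv
        · simp only [norm_zero]
          positivity
        · rw [not_le] at hv
          rw [Real.norm_of_nonneg (by positivity), Real.norm_of_nonneg (by positivity),
            div_eq_mul_one_div, mul_comm]
          gcongr
          linarith
      · simpa using Asymptotics.isLittleO_pow_id (𝕜 := ℝ) one_lt_two
    · simp only [not_le.mpr hu, if_false]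
      have h : HasDerivAt (fun v : ℝ => v ^ 2 / (v + ε)) (1 - ε ^ 2 / (u + ε) ^ 2) u := by
        have hne : u + ε ≠ 0 := by positivity
        refine ((hasDerivAt_pow 2 u).div ((hasDerivAt_id u).add_const ε) hne).congr_deriv ?_
        simp only [id_eq]
        field_simp
        push_cast
        ring
      refine h.congr_of_eventuallyEq ?_
      filter_upwards [Ioi_mem_nhds hu] with v hv
      simp [not_le.mpr (mem_Ioi.mp hv)]
  · intro u
    simp only
    split_ifs with hu
    · norm_num
    · rw [not_le] at hu
      have : ε ^ 2 / (u + ε) ^ 2 ≤ 1 := by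
        rw [div_le_one (by positivity)]
        gcongr
        linarith
      exact ⟨by linarith, by linarith [show 0 ≤ ε ^ 2 / (u + ε) ^ 2 by positivity]⟩
  · intro u hu
    simp [hu]
  · intro u hu
    simp only
    split_ifs with hu'
    · exact ⟨by linarith, le_rfl, hu⟩
    · rw [not_le] at hu'
      refine ⟨?_, by positivity, ?_⟩
      · rw [le_div_iff₀ (by positivity)]
        nlinarith
      · rw [div_le_iff₀ (by positivity)]
        nlinarith

section Bump

variable {E : Type*} [NormedAddCommGroup E] [InnerProductSpace ℝ E] [CompleteSpace E]

/-- Log-sum-exp smoothing of the support function of a finite set. -/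
lemma exists_smoothed_supportFunction {F : Finset E} (hF : F.Nonempty) {ε : ℝ} (hε : 0 < ε) :
    ∃ g : E → ℝ, (∀ y, ∃ z ∈ convexHull ℝ (F : Set E), HasGradientAt g z y) ∧
      (∀ q ∈ F, ∀ y, inner ℝ q y ≤ g y) ∧ g 0 ≤ ε := by
  obtain ⟨β, hβ, hβε⟩ : ∃ β : ℝ, 0 < β ∧ β⁻¹ * Real.log F.card ≤ ε := by
    have hlog : 0 ≤ Real.log F.card := Real.log_natCast_nonneg _
    -- The `+ 1` keeps `β` positive when `F` is a singleton.
    refine ⟨(Real.log F.card + 1) / ε, by positivity, ?_⟩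
    rw [inv_div, div_mul_eq_mul_div, div_le_iff₀ (by positivity)]
    nlinarith
  let S : E → ℝ := fun y => ∑ q ∈ F, Real.exp (β * inner ℝ q y)
  have hS : ∀ y, 0 < S y := fun y => Finset.sum_pos (fun _ _ => Real.exp_pos _) hF
  refine ⟨fun y => β⁻¹ * Real.log (S y), fun y => ?_, fun q hq y => ?_, ?_⟩
  · refine ⟨∑ q ∈ F, (Real.exp (β * inner ℝ q y) / S y) • q, ?_, ?_⟩
    · refine (convex_convexHull ℝ _).sum_mem (fun q _ => by have := hS y; positivity) ?_
        (fun q hq => subset_convexHull ℝ _ hq)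
      rw [← Finset.sum_div]
      exact div_self (hS y).ne'
    · rw [hasGradientAt_iff_hasFDerivAt]
      have h1 : ∀ q ∈ F, HasFDerivAt (fun y : E => Real.exp (β * inner ℝ q y))
          (Real.exp (β * inner ℝ q y) • (β • innerSL ℝ q)) y := fun q _ =>
        (((innerSL ℝ q).hasFDerivAt (x := y)).const_mul β).exp
      have h2 := ((HasFDerivAt.fun_sum h1).log (hS y).ne').const_mul β⁻¹
      refine h2.congr_fderiv ?_
      ext v
      simp only [smul_apply, sum_apply,
        innerSL_apply_apply, smul_eq_mul, InnerProductSpace.toDual_apply_apply, sum_inner,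
        inner_smul_left, Finset.mul_sum]
      refine Finset.sum_congr rfl fun q _ => ?_
      have := (hS y).ne'
      simp only [S] at this ⊢
      simp only [conj_trivial]
      field_simp
  · rw [le_inv_mul_iff₀ hβ, Real.le_log_iff_exp_le (hS y)]
    exact Finset.single_le_sum (f := fun q => Real.exp (β * inner ℝ q y))
      (fun _ _ => (Real.exp_pos _).le) hq
  · simpa [S] using hβε

/-- A compactly supported bump whose gradients lie near the convex hull of a given finite set `F`
and take values close to each point of `F`. -/
lemma exists_bump_gradient_near [FiniteDimensional ℝ E] {F : Finset E} (h0 : (0 : E) ∈ F)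
    {δ ρ r : ℝ} (hδ : 0 < δ) (hδ1 : δ < 1) (hρ : 0 < ρ) (hr : 0 < r) :
    ∃ b : E → ℝ,
      (∀ y, ∃ θ ∈ Icc (0 : ℝ) 1, ∃ z ∈ convexHull ℝ (F : Set E), ∃ e : E, ‖e‖ ≤ ρ ∧
        HasGradientAt b (θ • ((1 - δ) • z + δ • e)) y) ∧
      (∀ y, r ≤ ‖y‖ → b y = 0) ∧ (∀ y, |b y| ≤ δ * ρ * r / 2) ∧
      ∀ q ∈ F, ∃ y, ‖y‖ ≤ r ∧ HasGradientAt b ((1 - δ) ^ 2 • q) y := by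
  -- With this `c`, the quadratic term has gradient at most `δ * ρ` on the ball of radius `r`; with
  -- `a = c * r ^ 2`, the region `h < a` lies in that ball.
  set c : ℝ := δ * ρ / (2 * r) with hc
  have hc0 : 0 < c := by positivity
  set a : ℝ := c * r ^ 2 with ha
  have ha0 : 0 < a := by positivity
  obtain ⟨g, hg, hgF, hg0⟩ :=
    exists_smoothed_supportFunction ⟨0, h0⟩ (show 0 < δ * a / 4 by positivity)
  obtain ⟨Θ, Θ', hΘ, hΘ', hΘ0, hΘp⟩ := exists_smoothed_posPart (show 0 < δ * a / 4 by positivity)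
  have hgn : ∀ y, 0 ≤ g y := fun y => by simpa using hgF 0 h0 y
  choose z hz hgz using hg
  set h : E → ℝ := fun y => (1 - δ) * g y + c * ‖y‖ ^ 2 with hh
  have hhn : ∀ y, c * ‖y‖ ^ 2 ≤ h y := fun y => by
    have := mul_nonneg (sub_nonneg.mpr hδ1.le) (hgn y)
    simp only [hh]
    linarith
  have hgrad : ∀ y, HasGradientAt (fun y => -Θ (a - h y))
      (Θ' (a - h y) • ((1 - δ) • z y + (2 * c) • y)) y := by
    intro y
    rw [hasGradientAt_iff_hasFDerivAt]
    have h1 : HasFDerivAt (fun y : E => ‖y‖ ^ 2) (2 • innerSL ℝ y) y :=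
      (hasStrictFDerivAt_norm_sq y).hasFDerivAt
    have h2 := (((hasGradientAt_iff_hasFDerivAt.mp (hgz y)).const_mul (1 - δ)).add
      (h1.const_mul c)).const_sub a
    refine ((hΘ _).comp_hasFDerivAt y h2).neg.congr_fderiv ?_
    ext v
    simp
    ring
  refine ⟨fun y => -Θ (a - h y), fun y => ?_, fun y hy => ?_, fun y => ?_, fun q hq => ?_⟩
  · by_cases hy : a ≤ h y
    · refine ⟨0, by simp, 0, subset_convexHull ℝ _ h0, 0, by simpa using hρ.le, ?_⟩
      simpa [(hΘ0 _ (sub_nonpos.mpr hy)).2] using hgrad y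
    · refine ⟨Θ' (a - h y), hΘ' _, z y, hz y, (2 * c / δ) • y, ?_, ?_⟩
      · have hyr : ‖y‖ ≤ r := by
          have : c * ‖y‖ ^ 2 < c * r ^ 2 := (hhn y).trans_lt (not_le.mp hy)
          exact (lt_of_pow_lt_pow_left₀ 2 hr.le (lt_of_mul_lt_mul_left this hc0.le)).le
        rw [norm_smul, Real.norm_of_nonneg (by positivity)]
        calc 2 * c / δ * ‖y‖ ≤ 2 * c / δ * r := by gcongr
          _ = ρ := by rw [hc]; field_simp
      · rw [smul_smul, mul_div_cancel₀ _ hδ.ne']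
        exact hgrad y
  · have : a ≤ h y := le_trans (by rw [ha]; gcongr) (hhn y)
    simp [(hΘ0 _ (sub_nonpos.mpr this)).1]
  · have haeq : a = δ * ρ * r / 2 := by
      rw [ha, hc]
      field_simp
    rw [abs_neg, ← haeq]
    by_cases hy : a ≤ h y
    · simpa [(hΘ0 _ (sub_nonpos.mpr hy)).1] using ha0.le
    · obtain ⟨-, h1, h2⟩ := hΘp (a - h y) (by linarith)
      rw [abs_of_nonneg h1]
      have : 0 ≤ h y := le_trans (by positivity) (hhn y)
      linarith
  · have hcont : Continuous fun y => -Θ (a - h y) - inner ℝ ((1 - δ) ^ 2 • q) y := by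
      refine Continuous.sub ?_ (by fun_prop)
      exact continuous_iff_continuousAt.mpr fun y => (hgrad y).differentiableAt.continuousAt
    have hhc : Continuous h := by
      have : Continuous g := continuous_iff_continuousAt.mpr fun y =>
        (hgz y).differentiableAt.continuousAt
      fun_prop
    have hDr : ∀ y, h y ≤ a → ‖y‖ ≤ r := fun y hy =>
      (pow_le_pow_iff_left₀ (norm_nonneg _) hr.le two_ne_zero).mp (le_of_mul_le_mul_left ((hhn y).trans hy) hc0)
    have hD : IsCompact {y | h y ≤ a} :=
      Metric.isCompact_of_isClosed_isBounded (isClosed_le hhc continuous_const)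
        ((Metric.isBounded_closedBall (x := (0 : E)) (r := r)).subset fun y hy => by
          simpa using hDr y hy)
    have hh0 : h 0 ≤ δ * a / 4 := by
      simp only [hh, norm_zero]
      nlinarith [hgn 0]
    have h0D : h 0 ≤ a := by nlinarith
    obtain ⟨y, hyD, hymin⟩ := hD.exists_isMinOn ⟨0, h0D⟩ hcont.continuousOn
    -- On `h = a` the objective is at least `-(1 - δ) * a`, while at the origin it is at most `-(1 -
    -- δ / 2) * a`.
    have hylt : h y < a := by
      refine lt_of_le_of_ne hyD fun hya => ?_
      have h1 := hymin h0D
      simp only [mem_ofPred_eq, hya, sub_self, (hΘ0 0 le_rfl).1, inner_zero_right,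
        inner_smul_left, conj_trivial] at h1
      have h2 := (hΘp (a - h 0) (by linarith)).1
      have h3 : (1 - δ) * inner ℝ q y ≤ a := by
        have := mul_le_mul_of_nonneg_left (hgF q hq y) (sub_nonneg.mpr hδ1.le)
        have h4 : h y = (1 - δ) * g y + c * ‖y‖ ^ 2 := rfl
        have : 0 ≤ c * ‖y‖ ^ 2 := by positivity
        linarith
      have := mul_le_mul_of_nonneg_left h3 (sub_nonneg.mpr hδ1.le)
      nlinarith
    refine ⟨y, hDr y hyD, ?_⟩
    have hloc : IsLocalMin (fun y => -Θ (a - h y) - inner ℝ ((1 - δ) ^ 2 • q) y) y := by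
      refine hymin.isLocalMin ?_
      filter_upwards [hhc.continuousAt.eventually_lt_const hylt] with v hv using hv.le
    have hder := (hasGradientAt_iff_hasFDerivAt.mp (hgrad y)).sub
      ((innerSL ℝ ((1 - δ) ^ 2 • q)).hasFDerivAt (x := y))
    have hzero := hloc.hasFDerivAt_eq_zero hder
    have heq : Θ' (a - h y) • ((1 - δ) • z y + (2 * c) • y) = (1 - δ) ^ 2 • q := by
      apply (InnerProductSpace.toDual ℝ E).injective
      exact sub_eq_zero.mp hzero
    rw [← heq]
    exact hgrad y

end Bump

/-! ### Summing bumps in dyadic slabs. -/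

section Gluing

variable {E : Type*} [NormedAddCommGroup E] [InnerProductSpace ℝ E]
  {w : E →L[ℝ] ℝ} {b : ℕ → E → ℝ}

/-- Supports sit where `w` is between `7/8` and `9/8` of `2⁻ʲ`. The bounds `9/16` and `7/4` are the
top of the next slab and the bottom of the previous one; for `k = 0` there is no previous one. -/
lemma tsum_eq_of_dyadic_slab
    (hb : ∀ k y, b k y ≠ 0 → |w y - (1 / 2) ^ k| ≤ (1 / 2) ^ k / 8) {k : ℕ} {y : E}
    (h1 : 9 / 16 * (1 / 2) ^ k < w y) (h2 : k = 0 ∨ w y < 7 / 4 * (1 / 2) ^ k) :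
    ∑' j, b j y = b k y := by
  refine tsum_eq_single k fun j hj => ?_
  by_contra hne
  have hj' := abs_le.mp (hb j y hne)
  rcases lt_or_gt_of_ne hj with hlt | hlt
  · have h3 := h2.resolve_left (by omega)
    have : (1 / 2 : ℝ) ^ k ≤ (1 / 2) ^ (j + 1) :=
      pow_le_pow_of_le_one (by norm_num) (by norm_num) hlt
    rw [pow_succ] at this
    linarith
  · have : (1 / 2 : ℝ) ^ j ≤ (1 / 2) ^ (k + 1) :=
      pow_le_pow_of_le_one (by norm_num) (by norm_num) hlt
    rw [pow_succ] at this
    linarith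

lemma eventuallyEq_tsum_of_dyadic_slab
    (hb : ∀ k y, b k y ≠ 0 → |w y - (1 / 2) ^ k| ≤ (1 / 2) ^ k / 8) {k : ℕ} {y : E}
    (h1 : 9 / 16 * (1 / 2) ^ k < w y) (h2 : k = 0 ∨ w y < 7 / 4 * (1 / 2) ^ k) :
    (fun y => ∑' j, b j y) =ᶠ[𝓝 y] b k := by
  have e1 : ∀ᶠ v in 𝓝 y, 9 / 16 * (1 / 2) ^ k < w v :=
    w.continuous.continuousAt.eventually_const_lt h1
  have e2 : ∀ᶠ v in 𝓝 y, k = 0 ∨ w v < 7 / 4 * (1 / 2) ^ k := by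
    rcases h2 with h2 | h2
    · exact Eventually.of_forall fun _ => Or.inl h2
    · exact (w.continuous.continuousAt.eventually_lt_const h2).mono fun _ => Or.inr
  filter_upwards [e1, e2] with v hv1 hv2
  exact tsum_eq_of_dyadic_slab hb hv1 hv2

lemma exists_dyadic_slab {s : ℝ} (hs : 0 < s) :
    ∃ k : ℕ, 9 / 16 * (1 / 2) ^ k < s ∧ (k = 0 ∨ s < 7 / 4 * (1 / 2) ^ k) := by
  have hex : ∃ k : ℕ, 9 / 16 * (1 / 2 : ℝ) ^ k < s := by
    obtain ⟨k, hk⟩ := exists_pow_lt_of_lt_one hs (show (1 / 2 : ℝ) < 1 by norm_num)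
    exact ⟨k, by linarith [show (0 : ℝ) < (1 / 2) ^ k by positivity]⟩
  classical
  refine ⟨Nat.find hex, Nat.find_spec hex, ?_⟩
  rcases Nat.eq_zero_or_pos (Nat.find hex) with h0 | h0
  · exact Or.inl h0
  · refine Or.inr ?_
    obtain ⟨m, hm⟩ := Nat.exists_eq_succ_of_ne_zero h0.ne'
    have h1 := not_lt.mp (Nat.find_min hex (m := m) (by omega))
    rw [hm, Nat.succ_eq_add_one, pow_succ]
    have : (0 : ℝ) < (1 / 2) ^ m := by positivity
    linarith

variable [CompleteSpace E]

/-- On the support of `b k`, `w² ≥ (49/64) * 4⁻ᵏ ≥ 4⁻ᵏ / 2`, so the sum is bounded by `w²`. -/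
lemma hasGradientAt_zero_tsum_of_nonpos
    (hb : ∀ k y, b k y ≠ 0 → |w y - (1 / 2) ^ k| ≤ (1 / 2) ^ k / 8)
    (hbd : ∀ k y, |b k y| ≤ (1 / 4) ^ k / 2) {y : E} (hy : w y ≤ 0) :
    HasGradientAt (fun y => ∑' j, b j y) 0 y := by
  have hzero : ∀ v, w v ≤ 0 → ∑' j, b j v = 0 := by
    intro v hv
    have : ∀ j, b j v = 0 := by
      intro j
      by_contra hne
      have := abs_le.mp (hb j v hne)
      linarith [show (0 : ℝ) < (1 / 2) ^ j by positivity]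
    simp [this]
  have hsq : ∀ v, |∑' j, b j v| ≤ (w v) ^ 2 := by
    intro v
    rcases le_or_gt (w v) 0 with hv | hv
    · rw [hzero v hv, abs_zero]
      positivity
    · obtain ⟨k, h1, h2⟩ := exists_dyadic_slab hv
      rw [tsum_eq_of_dyadic_slab hb h1 h2]
      by_cases hne : b k v = 0
      · rw [hne, abs_zero]
        positivity
      · refine (hbd k v).trans ?_
        have h3 := abs_le.mp (hb k v hne)
        have h4 : (1 / 4 : ℝ) ^ k = ((1 / 2) ^ k) ^ 2 := by
          rw [← pow_mul, mul_comm, pow_mul]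
          norm_num
        have h5 : (0 : ℝ) < (1 / 2) ^ k := by positivity
        rw [h4]
        nlinarith
  rcases hy.lt_or_eq with hlt | heq
  · refine (hasGradientAt_const y (0 : ℝ)).congr_of_eventuallyEq ?_
    filter_upwards [w.continuous.continuousAt.eventually_lt_const hlt] with v hv
    exact hzero v hv.le
  · rw [hasGradientAt_iff_isLittleO]
    simp only [hzero y hy, inner_zero_left, sub_zero]
    refine Asymptotics.IsBigO.trans_isLittleO (g := fun v : E => ‖v - y‖ ^ 2) ?_ ?_
    · refine Asymptotics.IsBigO.of_bound (‖w‖ ^ 2) (Eventually.of_forall fun v => ?_)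
      have h1 : ‖w v‖ ≤ ‖w‖ * ‖v - y‖ := by simpa [map_sub, heq] using w.le_opNorm (v - y)
      rw [Real.norm_eq_abs, Real.norm_of_nonneg (by positivity), ← mul_pow]
      refine (hsq v).trans ?_
      rw [← sq_abs]
      exact pow_le_pow_left₀ (abs_nonneg _) h1 2
    · have h1 : Tendsto (fun v : E => v - y) (𝓝 y) (𝓝 0) := by
        have : Continuous fun v : E => v - y := by fun_prop
        simpa using this.tendsto y
      exact (Asymptotics.isLittleO_norm_pow_id one_lt_two).comp_tendsto h1

lemma HasGradientAt.comp_sub_const {β : E → ℝ} {c y g : E} (h : HasGradientAt β g (y - c)) :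
    HasGradientAt (fun y => β (y - c)) g y := by
  rw [hasGradientAt_iff_hasFDerivAt] at h ⊢
  exact (h.comp y ((hasFDerivAt_id y).sub_const c)).congr_fderiv (by ext; rfl)

end Gluing

/-! ### Computing the Clarke subdifferential. -/

/-- The limiting gradients already make up the closed convex set `K`, so the hull adds nothing. -/
lemma clarkeSubdifferential_eq_of_approx {N : ℕ} {f : EuclideanSpace ℝ (Fin N) → ℝ}
    (hf : Differentiable ℝ f) {x : EuclideanSpace ℝ (Fin N)}
    {K : Set (EuclideanSpace ℝ (Fin N))} (hK : IsClosed K) (hKc : Convex ℝ K)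
    (hsub : ∀ ε > 0, ∀ᶠ y in 𝓝 x, ∃ z ∈ K, dist (gradient f y) z < ε)
    (hsup : ∀ q ∈ K, ∀ ε > 0, ∃ y, dist y x < ε ∧ dist (gradient f y) q < ε) :
    clarkeSubdifferential f x = K := by
  have : limitingGradients f x = K := by
    apply Subset.antisymm
    · rintro p ⟨u, -, hux, hup⟩
      rw [← hK.closure_eq, Metric.mem_closure_iff]
      intro ε hε
      obtain ⟨n, ⟨z, hz, hn⟩, hn'⟩ := ((hux.eventually (hsub (ε / 2) (half_pos hε))).and
        (Metric.tendsto_nhds.mp hup (ε / 2) (half_pos hε))).exists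
      refine ⟨z, hz, ?_⟩
      have := dist_triangle_left p z (gradient f (u n))
      linarith
    · intro q hq
      choose u hu1 hu2 using fun n : ℕ => hsup q hq (1 / ((n : ℝ) + 1)) (by positivity)
      have h0 := tendsto_one_div_add_atTop_nhds_zero_nat (𝕜 := ℝ)
      exact ⟨u, fun n => hf _,
        tendsto_iff_dist_tendsto_zero.mpr (squeeze_zero (fun _ => dist_nonneg)
          (fun n => (hu1 n).le) h0),
        tendsto_iff_dist_tendsto_zero.mpr (squeeze_zero (fun _ => dist_nonneg)
          (fun n => (hu2 n).le) h0)⟩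
  rw [clarkeSubdifferential, this, hKc.convexHull_eq]

lemma clarkeSubdifferential_subset_of_gradient_mem {N : ℕ} {f : EuclideanSpace ℝ (Fin N) → ℝ}
    {C : Set (EuclideanSpace ℝ (Fin N))} (hC : IsClosed C) (hCc : Convex ℝ C)
    (h : ∀ y, gradient f y ∈ C) (x : EuclideanSpace ℝ (Fin N)) :
    clarkeSubdifferential f x ⊆ C := by
  refine convexHull_min ?_ hCc
  rintro p ⟨u, -, -, hup⟩
  exact hC.mem_of_tendsto hup (Eventually.of_forall fun n => h _)

/-! ### The construction of `f`. -/

/-- The case of a convex body with the origin in its interior. -/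
theorem exists_clarkeSubdifferential_universal {N : ℕ} (hN : 2 ≤ N)
    {C : Set (EuclideanSpace ℝ (Fin N))} (hCconv : Convex ℝ C) (hCcomp : IsCompact C)
    (hC0 : (0 : EuclideanSpace ℝ (Fin N)) ∈ interior C) {L : ℝ≥0} (hL : ∀ x ∈ C, ‖x‖ ≤ L) :
    ∃ f : EuclideanSpace ℝ (Fin N) → ℝ,
      Differentiable ℝ f ∧ LipschitzWith L f ∧ HasCompactSupport f ∧
      (∀ K ∈ compactConvexSubsetsZero C, ∃ x, clarkeSubdifferential f x = K) ∧
      ∀ x, clarkeSubdifferential f x ⊆ C := by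
  have h0C : (0 : EuclideanSpace ℝ (Fin N)) ∈ C := interior_subset hC0
  obtain ⟨ρ, hρ0, hρ1, hρC⟩ : ∃ ρ : ℝ, 0 < ρ ∧ ρ ≤ 1 ∧
      Metric.closedBall (0 : EuclideanSpace ℝ (Fin N)) ρ ⊆ C := by
    obtain ⟨ρ, hρ, h⟩ := Metric.nhds_basis_closedBall.mem_iff.mp (mem_interior_iff_mem_nhds.mp hC0)
    exact ⟨min ρ 1, lt_min hρ one_pos, min_le_right _ _,
      (Metric.closedBall_subset_closedBall (min_le_left _ _)).trans h⟩
  obtain ⟨t, F, ht, hF, happ⟩ := exists_seq_finset_approximating hCcomp h0C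
  -- Two coordinates are needed: `i` carries the code, `j` separates the bumps.
  let i : Fin N := ⟨0, by omega⟩
  let j : Fin N := ⟨1, by omega⟩
  have hij : i ≠ j := by simp [i, j, Fin.ext_iff]
  let w : EuclideanSpace ℝ (Fin N) →L[ℝ] ℝ := EuclideanSpace.proj j
  let c : ℕ → EuclideanSpace ℝ (Fin N) := fun k =>
    EuclideanSpace.single i (t k) + EuclideanSpace.single j ((1 / 2) ^ k)
  have hci : ∀ k, c k i = t k := fun k => by simp [c, hij]
  have hcj : ∀ k, c k j = (1 / 2) ^ k := fun k => by simp [c, hij.symm]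
  let δ : ℕ → ℝ := fun k => 1 / ((k : ℝ) + 2)
  have hδ0 : ∀ k, 0 < δ k := fun k => by positivity
  have hδ1 : ∀ k, δ k < 1 := fun k => by
    rw [div_lt_one (by positivity)]
    linarith [(Nat.cast_nonneg k : (0 : ℝ) ≤ k)]
  let r : ℕ → ℝ := fun k => (1 / 4) ^ k / 8
  have hr0 : ∀ k, 0 < r k := fun k => by positivity
  have hr : ∀ k, r k ≤ (1 / 2) ^ k / 8 := fun k => by
    have : (1 / 4 : ℝ) ^ k ≤ (1 / 2) ^ k := pow_le_pow_left₀ (by norm_num) (by norm_num) k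
    simp only [r]
    linarith
  choose β hβg hβ0 hβb hβq using fun k =>
    exists_bump_gradient_near (hF k).1 (hδ0 k) (hδ1 k) hρ0 (hr0 k)
  let b : ℕ → EuclideanSpace ℝ (Fin N) → ℝ := fun k y => β k (y - c k)
  have hslab : ∀ k y, ‖y - c k‖ ≤ r k → |w y - (1 / 2) ^ k| ≤ (1 / 2) ^ k / 8 := by
    intro k y hy
    have h1 := (PiLp.norm_apply_le (y - c k) j).trans (hy.trans (hr k))
    rwa [PiLp.sub_apply, hcj, Real.norm_eq_abs] at h1
  have hbsupp : ∀ k y, b k y ≠ 0 → ‖y - c k‖ ≤ r k := fun k y hy => by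
    by_contra hlt
    exact hy (hβ0 k _ (not_le.mp hlt).le)
  have hb : ∀ k y, b k y ≠ 0 → |w y - (1 / 2) ^ k| ≤ (1 / 2) ^ k / 8 := fun k y hy =>
    hslab k y (hbsupp k y hy)
  have hbd : ∀ k y, |b k y| ≤ (1 / 4) ^ k / 2 := fun k y => by
    refine (hβb k _).trans ?_
    have h1 : δ k * ρ ≤ 1 := mul_le_one₀ (hδ1 k).le hρ0.le hρ1
    have h2 : δ k * ρ * r k ≤ 1 * r k := by gcongr
    have h3 : (0 : ℝ) < (1 / 4) ^ k := by positivity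
    simp only [r] at h2 ⊢
    linarith
  let f : EuclideanSpace ℝ (Fin N) → ℝ := fun y => ∑' k, b k y
  have hcase : ∀ y, HasGradientAt f 0 y ∨ ∃ k, ‖y - c k‖ ≤ r k ∧ ∃ θ ∈ Icc (0 : ℝ) 1,
      ∃ z ∈ convexHull ℝ (F k : Set (EuclideanSpace ℝ (Fin N))),
      ∃ e : EuclideanSpace ℝ (Fin N), ‖e‖ ≤ ρ ∧
        HasGradientAt f (θ • ((1 - δ k) • z + δ k • e)) y := by
    intro y
    rcases le_or_gt (w y) 0 with hy | hy
    · exact Or.inl (hasGradientAt_zero_tsum_of_nonpos hb hbd hy)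
    · obtain ⟨k, h1, h2⟩ := exists_dyadic_slab hy
      have hfk : f =ᶠ[𝓝 y] b k := eventuallyEq_tsum_of_dyadic_slab hb h1 h2
      by_cases hyk : ‖y - c k‖ ≤ r k
      · obtain ⟨θ, hθ, z, hz, e, he, hgr⟩ := hβg k (y - c k)
        exact Or.inr ⟨k, hyk, θ, hθ, z, hz, e, he,
          hgr.comp_sub_const.congr_of_eventuallyEq hfk⟩
      · refine Or.inl ((hasGradientAt_const y (0 : ℝ)).congr_of_eventuallyEq (hfk.trans ?_))
        have : Continuous fun v => ‖v - c k‖ := by fun_prop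
        filter_upwards [this.continuousAt.eventually_const_lt (not_le.mp hyk)] with v hv
        exact hβ0 k _ hv.le
  have hdiff : Differentiable ℝ f := fun y => by
    rcases hcase y with h | ⟨k, -, θ, -, z, -, e, -, h⟩ <;> exact h.differentiableAt
  have hgC : ∀ y, gradient f y ∈ C := by
    intro y
    rcases hcase y with h | ⟨k, -, θ, hθ, z, hz, e, he, h⟩
    · rwa [h.gradient]
    · rw [h.gradient]
      refine hCconv.smul_mem_of_zero_mem h0C ?_ hθ
      -- The error `e` lies in the ball of radius `ρ` inside `C`, so the gradient is a convex
      -- combination of points of `C`, scaled towards `0`.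
      exact hCconv (convexHull_min (hF k).2 hCconv hz) (hρC (by simpa using he))
        (sub_nonneg.mpr (hδ1 k).le) (hδ0 k).le (by ring)
  have hr_tendsto : Tendsto r atTop (𝓝 0) := by
    simpa [r] using (tendsto_pow_atTop_nhds_zero_of_lt_one (r := (1 / 4 : ℝ)) (by norm_num)
      (by norm_num)).div_const 8
  have hh_tendsto : Tendsto (fun k : ℕ => (1 / 2 : ℝ) ^ k) atTop (𝓝 0) :=
    tendsto_pow_atTop_nhds_zero_of_lt_one (by norm_num) (by norm_num)
  have hδ_tendsto : Tendsto δ atTop (𝓝 0) :=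
    squeeze_zero (fun k => (hδ0 k).le)
      (fun k => one_div_le_one_div_of_le (by positivity) (by linarith))
      (tendsto_one_div_add_atTop_nhds_zero_nat (𝕜 := ℝ))
  refine ⟨f, hdiff, ?_, ?_, ?_,
    clarkeSubdifferential_subset_of_gradient_mem hCcomp.isClosed hCconv hgC⟩
  · refine lipschitzWith_of_nnnorm_fderiv_le hdiff fun y => ?_
    rw [← NNReal.coe_le_coe, coe_nnnorm, ← toDual_gradient, LinearIsometryEquiv.norm_map]
    exact hL _ (hgC y)
  · refine HasCompactSupport.intro (isCompact_closedBall (0 : EuclideanSpace ℝ (Fin N)) 3)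
      fun y hy => ?_
    have : ∀ k, b k y = 0 := by
      intro k
      by_contra hne
      refine hy ?_
      rw [mem_closedBall_zero_iff]
      have h1 := hbsupp k y hne
      have h2 : ‖c k‖ ≤ 2 := by
        refine (norm_add_le _ _).trans ?_
        rw [PiLp.norm_single, PiLp.norm_single, Real.norm_eq_abs,
          abs_of_nonneg (ht k).1, Real.norm_of_nonneg (by positivity)]
        have : (1 / 2 : ℝ) ^ k ≤ 1 := pow_le_one₀ (by norm_num) (by norm_num)
        linarith [(ht k).2]
      have h3 : r k ≤ 1 := by
        have : (1 / 4 : ℝ) ^ k ≤ 1 := pow_le_one₀ (by norm_num) (by norm_num)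
        simp only [r]
        linarith
      have := norm_add_le (y - c k) (c k)
      rw [sub_add_cancel] at this
      linarith
    simp [f, this]
  rintro K ⟨⟨hKC, -, hKcomp, hKconv⟩, hK0⟩
  obtain ⟨x, hxf, hxa⟩ := happ K hKC hKcomp hK0
  refine ⟨EuclideanSpace.single i x, clarkeSubdifferential_eq_of_approx hdiff hKcomp.isClosed
    hKconv (fun ε hε => ?_) fun q hq ε hε => ?_⟩
  · obtain ⟨η, hη, n₀, hn₀⟩ := hxa (ε / 2) (half_pos hε)
    obtain ⟨n, hn⟩ := eventually_atTop.mp ((eventually_ge_atTop n₀).and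
      ((hr_tendsto.eventually_lt_const (half_pos hη)).and
        (hδ_tendsto.eventually_lt_const (half_pos hε))))
    have ei : ∀ᶠ y : EuclideanSpace ℝ (Fin N) in 𝓝 (EuclideanSpace.single i x),
        |y i - x| < η / 2 := by
      have : Continuous fun y : EuclideanSpace ℝ (Fin N) => |y i - x| := by fun_prop
      exact this.continuousAt.eventually_lt_const (by simpa using hη)
    have ej : ∀ᶠ y : EuclideanSpace ℝ (Fin N) in 𝓝 (EuclideanSpace.single i x),
        w y < 7 / 8 * (1 / 2) ^ n :=
      w.continuous.continuousAt.eventually_lt_const (by simp [w, hij.symm])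
    filter_upwards [ei, ej] with y hyi hyj
    rcases hcase y with h | ⟨k, hyk, θ, hθ, z, hz, e, he, h⟩
    · exact ⟨0, hK0, by simpa [h.gradient] using hε⟩
    -- An earlier bump lives at height at least `7/8 * 2⁻ⁿ`, above `y`.
    have hnk : n ≤ k := by
      by_contra hlt
      have h1 : (1 / 2 : ℝ) ^ n ≤ (1 / 2) ^ k :=
        pow_le_pow_of_le_one (by norm_num) (by norm_num) (not_le.mp hlt).le
      have := abs_le.mp (hslab k y hyk)
      linarith
    obtain ⟨hk1, hk2, hk3⟩ := hn k hnk
    have htx : |t k - x| < η := by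
      have h1 := (PiLp.norm_apply_le (y - c k) i).trans hyk
      rw [PiLp.sub_apply, hci, Real.norm_eq_abs, abs_sub_comm] at h1
      have := abs_sub_le (t k) (y i) x
      linarith
    obtain ⟨z', hz', hzz'⟩ := Metric.mem_thickening_iff.mp
      (convexHull_min (hn₀ k hk1 htx).1 (hKconv.thickening _) hz)
    refine ⟨(θ * (1 - δ k)) • z', hKconv.smul_mem_of_zero_mem hK0 hz'
      ⟨mul_nonneg hθ.1 (sub_nonneg.mpr (hδ1 k).le),
        mul_le_one₀ hθ.2 (sub_nonneg.mpr (hδ1 k).le) (by linarith [hδ0 k])⟩, ?_⟩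
    have hsplit : θ • ((1 - δ k) • z + δ k • e) - (θ * (1 - δ k)) • z' =
        (θ * (1 - δ k)) • (z - z') + (θ * δ k) • e := by module
    rw [h.gradient, dist_eq_norm, hsplit]
    refine (norm_add_le _ _).trans_lt ?_
    have h1 : 0 ≤ θ * (1 - δ k) := mul_nonneg hθ.1 (sub_nonneg.mpr (hδ1 k).le)
    have h2 : θ * (1 - δ k) ≤ 1 :=
      mul_le_one₀ hθ.2 (sub_nonneg.mpr (hδ1 k).le) (by linarith [hδ0 k])
    have h3 : θ * δ k ≤ δ k := mul_le_of_le_one_left (hδ0 k).le hθ.2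
    rw [norm_smul, norm_smul, Real.norm_of_nonneg h1,
      Real.norm_of_nonneg (mul_nonneg hθ.1 (hδ0 k).le), ← dist_eq_norm]
    have h4 := mul_le_of_le_one_left (dist_nonneg (x := z) (y := z')) h2
    have h5 : θ * δ k * ‖e‖ ≤ δ k * 1 :=
      mul_le_mul h3 (he.trans hρ1) (norm_nonneg _) (hδ0 k).le
    linarith
  · obtain ⟨η, hη, n₀, hn₀⟩ := hxa (ε / 2) (half_pos hε)
    -- The attained gradient `(1 - δ k) ^ 2 • q'` misses `q'` by at most `2 * δ k * L`.
    have hδL : Tendsto (fun k => 2 * δ k * (L : ℝ)) atTop (𝓝 0) := by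
      simpa using (hδ_tendsto.const_mul 2).mul_const (L : ℝ)
    obtain ⟨n, hn⟩ := eventually_atTop.mp ((eventually_ge_atTop n₀).and
      ((hr_tendsto.eventually_lt_const (show 0 < ε / 3 by positivity)).and
        ((hh_tendsto.eventually_lt_const (show 0 < ε / 3 by positivity)).and
          (hδL.eventually_lt_const (half_pos hε)))))
    obtain ⟨k, hnk, hkx⟩ := hxf (min η (ε / 3)) (lt_min hη (by positivity)) n
    obtain ⟨hk1, hk2, hk3, hk4⟩ := hn k hnk
    obtain ⟨q', hq', hqq'⟩ := Metric.mem_thickening_iff.mp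
      ((hn₀ k hk1 (hkx.trans_le (min_le_left _ _))).2 hq)
    obtain ⟨y, hyr, hy⟩ := hβq k q' hq'
    have hpos : (0 : ℝ) < (1 / 2) ^ k := by positivity
    have hw := abs_le.mp (hslab k (y + c k) (by simpa using hyr))
    have hgr : HasGradientAt f ((1 - δ k) ^ 2 • q') (y + c k) := by
      have h1 : HasGradientAt (b k) ((1 - δ k) ^ 2 • q') (y + c k) :=
        HasGradientAt.comp_sub_const (by simpa using hy)
      exact h1.congr_of_eventuallyEq (eventuallyEq_tsum_of_dyadic_slab hb
        (by linarith) (Or.inr (by linarith)))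
    refine ⟨y + c k, ?_, ?_⟩
    · have hsplit : y + c k - EuclideanSpace.single i x = y +
          (EuclideanSpace.single i (t k - x) + EuclideanSpace.single j ((1 / 2) ^ k)) := by
        ext l
        simp only [c, PiLp.add_apply, PiLp.sub_apply, PiLp.single_apply]
        split_ifs <;> ring
      rw [dist_eq_norm, hsplit]
      have h1 := norm_add_le y
        (EuclideanSpace.single i (t k - x) + EuclideanSpace.single j ((1 / 2) ^ k))
      have h2 := norm_add_le (EuclideanSpace.single i (t k - x))
        (EuclideanSpace.single j ((1 / 2 : ℝ) ^ k))
      rw [PiLp.norm_single, PiLp.norm_single, Real.norm_eq_abs,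
        Real.norm_of_nonneg hpos.le] at h2
      linarith [hkx.trans_le (min_le_right _ _)]
    · rw [hgr.gradient, dist_eq_norm]
      have hsplit : (1 - δ k) ^ 2 • q' - q = -((1 - (1 - δ k) ^ 2) • q') + (q' - q) := by module
      rw [hsplit]
      refine (norm_add_le _ _).trans_lt ?_
      have h1 : 0 ≤ 1 - (1 - δ k) ^ 2 := by nlinarith [hδ0 k, hδ1 k]
      have h2 : 1 - (1 - δ k) ^ 2 ≤ 2 * δ k := by nlinarith
      rw [norm_neg, norm_smul, Real.norm_of_nonneg h1, ← dist_eq_norm, dist_comm]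
      have h3 := mul_le_mul h2 (hL q' ((hF k).2 hq')) (norm_nonneg _)
        (by linarith [hδ0 k])
      linarith

theorem mainTheorem5 (N : ℕ) (hN : 2 ≤ N)
    (C : Set (EuclideanSpace ℝ (Fin N))) (hCconv : Convex ℝ C) (hCcomp : IsCompact C)
    (hC0 : (0 : EuclideanSpace ℝ (Fin N)) ∈ C)
    (L : ℝ≥0) (hL : IsGreatest ((fun x : EuclideanSpace ℝ (Fin N) => ‖x‖) '' C) (L : ℝ)) :
    (∃ f : EuclideanSpace ℝ (Fin N) → ℝ,
      Differentiable ℝ f ∧ LipschitzWith L f ∧ HasCompactSupport f ∧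
      ∀ K ∈ compactConvexSubsetsZero C, ∃ x, clarkeSubdifferential f x = K) ∧
    ((0 : EuclideanSpace ℝ (Fin N)) ∈ interior C →
      ∃ f : EuclideanSpace ℝ (Fin N) → ℝ,
        Differentiable ℝ f ∧ LipschitzWith L f ∧ HasCompactSupport f ∧
        (∀ K ∈ compactConvexSubsetsZero C, ∃ x, clarkeSubdifferential f x = K) ∧
        ∀ x, clarkeSubdifferential f x ⊆ C) := by
  have hL' : ∀ x ∈ C, ‖x‖ ≤ L := fun x hx => hL.2 (mem_image_of_mem _ hx)
  refine ⟨?_, fun h => exists_clarkeSubdifferential_universal hN hCconv hCcomp h hL'⟩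
  -- For `L = 0` the ball has empty interior, but then `C = {0}` and `f = 0` works.
  rcases eq_or_ne L 0 with rfl | hL0
  · refine ⟨fun _ => 0, differentiable_const _, LipschitzWith.const 0, HasCompactSupport.zero, ?_⟩
    rintro K ⟨⟨hKC, -, hK, hKconv⟩, hK0⟩
    have hCz : ∀ z ∈ K, z = 0 := fun z hz => by simpa using hL' z (hKC hz)
    refine ⟨0, clarkeSubdifferential_eq_of_approx (differentiable_const _) hK.isClosed hKconv
      (fun ε hε => Eventually.of_forall fun y => ⟨0, hK0, by simpa using hε⟩) fun q hq ε hε => ?_⟩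
    exact ⟨0, by simpa using hε, by simpa [hCz q hq] using hε⟩
  · have hLpos : (0 : ℝ) < L := NNReal.coe_pos.mpr (pos_iff_ne_zero.mpr hL0)
    obtain ⟨f, h1, h2, h3, h4, -⟩ := exists_clarkeSubdifferential_universal hN
      (convex_closedBall (0 : EuclideanSpace ℝ (Fin N)) L)
      (isCompact_closedBall _ _) (mem_interior_iff_mem_nhds.mpr (Metric.closedBall_mem_nhds _ hLpos))
      (L := L) (fun x hx => by simpa using hx)
    refine ⟨f, h1, h2, h3, fun K hK => h4 K ⟨⟨fun z hz => ?_, hK.1.2⟩, hK.2⟩⟩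
    simpa using hL' z (hK.1.1 hz)
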